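/- Let $d\ge 2$, let $\mathbb S^d$ be the unit sphere in $\mathbb R^{d+1}$, let $\sigma_d$ be its normalized (total mass $1$) uniform surface area measure, and for $x\in\mathbb S^d$, $t\in[-1,1]$ let $C(x,t)=\{z\in\mathbb S^d : z\cdot x\ge t\}$. The spherical cap $\mathbb L_2$-discrepancy of $x_1,\dots,x_N\in\mathbb S^d$ is $$D(x_1,\dots,x_N)=\left(\int_{-1}^{1}\int_{\mathbb S^d}\left|\frac{|\{k : x_k\in C(x,t)\}|}{N}-\sigma_d(C(x,t))\right|^2 d\sigma_d(x)\,dt\right)^{1/2}.$$ Put $$C_d=\frac1d\,\frac{\Gamma(\frac{d+1}{2})}{\sqrt\pi\,\Gamma(\frac d2)},\qquad c_d^*=\sqrt{\frac{C_d}{2\sqrt\pi}\,\frac{1}{1+\frac1d}\left(\frac{\Gamma(\frac32)}{\Gamma(\frac{d+3}{2})}\right)^{1/d}}.$$ Then for all $d\ge2$, all $N\ge 2$ and all points $x_1,\dots,x_N\in\mathbb S^d$ (not necessarily distinct), $$D(x_1,\dots,x_N)\ \ge\ c_d^*\,N^{-\frac12-\frac1{2d}}.$$ In particular, $c_2^*=\sqrt{\dfrac{1}{6\sqrt{6\pi}}}$.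 -/

import Mathlib

open MeasureTheory

namespace CapDiscrepancy

noncomputable section

/-- The unit sphere `S^d` in the Euclidean space `ℝ^(d+1)`. -/
abbrev Sph (d : ℕ) : Type :=
  Metric.sphere (0 : EuclideanSpace ℝ (Fin (d + 1))) 1

/-- The normalized uniform surface area measure `σ_d` on `S^d`. -/
def sigma (d : ℕ) : Measure (Sph d) :=
  ((volume : Measure (EuclideanSpace ℝ (Fin (d + 1)))).toSphere Set.univ)⁻¹ •
    (volume : Measure (EuclideanSpace ℝ (Fin (d + 1)))).toSphere

instance sigma_isProbabilityMeasure (d : ℕ) : IsProbabilityMeasure (sigma d) := by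
  refine ⟨?_⟩
  have h0 : (volume : Measure (EuclideanSpace ℝ (Fin (d + 1)))).toSphere Set.univ ≠ 0 :=
    Measure.measure_univ_ne_zero.2 (Measure.toSphere_ne_zero _)
  simp only [sigma, Measure.smul_apply, smul_eq_mul]
  exact ENNReal.inv_mul_cancel h0 (measure_ne_top _ _)

/-- The spherical cap `C(x, t) = {z ∈ S^d : z · x ≥ t}`. -/
def cap {d : ℕ} (x : Sph d) (t : ℝ) : Set (Sph d) :=
  {z | t ≤ inner ℝ (z : EuclideanSpace ℝ (Fin (d + 1))) (x : EuclideanSpace ℝ (Fin (d + 1)))}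

/-- The spherical cap `L₂`-discrepancy of the points `p 0, …, p (N - 1)` on `S^d`
(points are counted with multiplicity). -/
def discrepancy {d N : ℕ} (p : Fin N → Sph d) : ℝ :=
  √(∫ t in (-1 : ℝ)..1, ∫ x,
      |(({k : Fin N | p k ∈ cap x t}.ncard : ℕ) : ℝ) / (N : ℝ) - (sigma d).real (cap x t)| ^ 2
      ∂(sigma d))

/-- `C_d = (1/d) Γ((d+1)/2) / (√π Γ(d/2))`. -/
def Cconst (d : ℕ) : ℝ :=
  1 / (d : ℝ) * (Real.Gamma (((d : ℝ) + 1) / 2) / (√Real.pi * Real.Gamma ((d : ℝ) / 2)))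

/-- The constant `c_d^*`. -/
def cStar (d : ℕ) : ℝ :=
  √(Cconst d / (2 * √Real.pi) * (1 / (1 + 1 / (d : ℝ))) *
    (Real.Gamma (3 / 2) / Real.Gamma (((d : ℝ) + 3) / 2)) ^ (1 / (d : ℝ)))

end

end CapDiscrepancy

/-! Stolarsky's principle (`discrepancy_eq`) turns the squared discrepancy into `C_d` times a
distance gap: the mean distance on the sphere minus the average of `‖x_j - x_k‖` over all pairs. So
the gap must be bounded below by a multiple of `N^(-1-1/d)`.

Subordination, `2√π u = ∫₀^∞ (1 - exp(-s u²)) s^(-3/2) ds`, writes the distance gap as the integral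
of `gaussGap · s^(-3/2)`, where `gaussGap` is the Gaussian energy of the points minus that of `σ_d`
(`distance_gap_eq`). The Gaussian kernel is positive definite and its mean over the sphere does not
depend on the centre, so `gaussGap ≥ 0` for every `s > 0` (`gaussian_energy_nonneg`). For `s ≥ 2`
the diagonal pairs alone contribute `1/N`, while the energy of `σ_d` is at most `A s^(-d/2)` with `A
= gaussConst d` (`gaussian_mean_le`). Integrating `1/N - A s^(-d/2)` over the range where it is
positive, `s > (A N)^(2/d)`, and discarding the rest gives exactly the stated constant. -/

open MeasureTheory Filter Topology

namespace CapDiscrepancy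

/-- The Euclidean space `ℝ^(d+1)` containing `S^d`. -/
abbrev Euc (d : ℕ) : Type := EuclideanSpace ℝ (Fin (d + 1))

/-- The total surface area of `S^d`. -/
noncomputable def area (d : ℕ) : ℝ := (volume : Measure (Euc d)).toSphere.real Set.univ

lemma area_pos (d : ℕ) : 0 < area d := by
  refine ENNReal.toReal_pos ?_ (measure_ne_top _ _)
  exact Measure.measure_univ_ne_zero.2 (Measure.toSphere_ne_zero _)

lemma integral_sigma {d : ℕ} (f : Sph d → ℝ) :
    ∫ x, f x ∂(sigma d) = (area d)⁻¹ * ∫ x, f x ∂(volume : Measure (Euc d)).toSphere := by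
  rw [sigma, integral_smul_measure, ENNReal.toReal_inv, smul_eq_mul]
  rfl

/-! ### Polar coordinates and the area of the sphere. -/

section Polar

variable {d : ℕ}

lemma integral_volumeIoiPow (n : ℕ) (h : ℝ → ℝ) :
    ∫ r : Set.Ioi (0 : ℝ), h r ∂(Measure.volumeIoiPow n) = ∫ r in Set.Ioi (0 : ℝ), r ^ n * h r := by
  simp only [Measure.volumeIoiPow, ENNReal.ofReal]
  rw [integral_withDensity_eq_integral_smul
      ((measurable_subtype_coe.pow_const _).real_toNNReal),
    integral_subtype_comap measurableSet_Ioi fun a ↦ Real.toNNReal (a ^ n) • h a,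
    setIntegral_congr_fun measurableSet_Ioi fun x hx ↦ ?_]
  rw [NNReal.smul_def, Real.coe_toNNReal _ (pow_nonneg hx.out.le _), smul_eq_mul]

lemma polar_comp_eq (f : Euc d → ℝ) (x : ({0}ᶜ : Set (Euc d))) :
    f x = (fun p : Sph d × Set.Ioi (0 : ℝ) => f ((p.2 : ℝ) • (p.1 : Euc d)))
      (homeomorphUnitSphereProd (Euc d) x) := by
  have := homeomorphUnitSphereProd_symm_apply_coe (Euc d) (homeomorphUnitSphereProd (Euc d) x)
  rw [Homeomorph.symm_apply_apply] at this
  simp only [← this]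

lemma measurePreserving_polar (d : ℕ) :
    MeasurePreserving (homeomorphUnitSphereProd (Euc d)) ((volume : Measure (Euc d)).comap (↑))
      ((volume : Measure (Euc d)).toSphere.prod (Measure.volumeIoiPow d)) := by
  simpa using (volume : Measure (Euc d)).measurePreserving_homeomorphUnitSphereProd

lemma integral_polar (f : Euc d → ℝ) :
    ∫ y, f y = ∫ p : Sph d × Set.Ioi (0 : ℝ), f ((p.2 : ℝ) • (p.1 : Euc d))
      ∂((volume : Measure (Euc d)).toSphere.prod (Measure.volumeIoiPow d)) := by
  rw [← (measurePreserving_polar d).integral_comp (Homeomorph.measurableEmbedding _)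
    (fun p : Sph d × Set.Ioi (0 : ℝ) => f ((p.2 : ℝ) • (p.1 : Euc d)))]
  simp_rw [← polar_comp_eq f]
  rw [integral_subtype_comap (measurableSet_singleton _).compl f, restrict_compl_singleton]

lemma integrable_polar {f : Euc d → ℝ} (hf : Integrable f) :
    Integrable (fun p : Sph d × Set.Ioi (0 : ℝ) => f ((p.2 : ℝ) • (p.1 : Euc d)))
      ((volume : Measure (Euc d)).toSphere.prod (Measure.volumeIoiPow d)) := by
  rw [← (measurePreserving_polar d).integrable_comp_emb (Homeomorph.measurableEmbedding _)]
  have : ((fun p : Sph d × Set.Ioi (0 : ℝ) => f ((p.2 : ℝ) • (p.1 : Euc d))) ∘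
      homeomorphUnitSphereProd (Euc d)) = fun x : ({0}ᶜ : Set (Euc d)) => f x :=
    funext fun x => (polar_comp_eq f x).symm
  rw [this]
  have := hf.integrableOn (s := ({0}ᶜ : Set (Euc d)))
  rwa [integrableOn_iff_comap_subtypeVal (measurableSet_singleton _).compl] at this

lemma integral_sphere_prod (g : Sph d → ℝ) (h : ℝ → ℝ) :
    ∫ p : Sph d × Set.Ioi (0 : ℝ), g p.1 * h p.2
      ∂((volume : Measure (Euc d)).toSphere.prod (Measure.volumeIoiPow d)) =
      area d * (∫ x, g x ∂(sigma d)) * ∫ r in Set.Ioi (0 : ℝ), r ^ d * h r := by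
  rw [integral_prod_mul g (fun r : Set.Ioi (0 : ℝ) => h r), integral_volumeIoiPow, integral_sigma,
    mul_inv_cancel_left₀ (area_pos d).ne']

lemma integral_pow_mul_exp_neg_sq (n : ℕ) :
    ∫ r in Set.Ioi (0 : ℝ), r ^ n * Real.exp (-r ^ 2) = Real.Gamma (((n : ℝ) + 1) / 2) / 2 := by
  have := integral_rpow_mul_exp_neg_rpow (p := 2) (q := n) two_pos (by linarith [n.cast_nonneg (α := ℝ)])
  simp only [Real.rpow_natCast, Real.rpow_ofNat] at this
  rw [this]
  ring

lemma norm_sph (x : Sph d) : ‖(x : Euc d)‖ = 1 := norm_eq_of_mem_sphere x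

/-- The integral of `exp(-‖y‖²)` over `ℝ^(d+1)`, computed in polar coordinates and in closed form.
-/
lemma area_mul_Gamma (d : ℕ) :
    area d * (Real.Gamma (((d : ℝ) + 1) / 2) / 2) = Real.pi ^ (((d : ℝ) + 1) / 2) := by
  have h1 := GaussianFourier.integral_rexp_neg_mul_sq_norm (V := Euc d) (b := 1) one_pos
  rw [integral_polar] at h1
  have h2 := integral_sphere_prod (d := d) (fun _ => 1) (fun r => Real.exp (-r ^ 2))
  simp only [integral_const, probReal_univ, smul_eq_mul, mul_one, one_mul,
    integral_pow_mul_exp_neg_sq] at h2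
  rw [← h2]
  simp only [neg_mul, one_mul, finrank_euclideanSpace, Fintype.card_fin, div_one] at h1
  push_cast at h1
  rw [← h1]
  congr 1
  ext p
  rw [norm_smul, norm_sph, mul_one, Real.norm_eq_abs, sq_abs]

end Polar

/-! ### Orthogonal invariance of the surface measure. -/

section Rotation

variable {d : ℕ}

/-- The action of a linear isometry on the sphere. -/
noncomputable def sphMap (L : Euc d ≃ₗᵢ[ℝ] Euc d) (x : Sph d) : Sph d :=
  ⟨L x, by simp⟩

@[simp] lemma coe_sphMap (L : Euc d ≃ₗᵢ[ℝ] Euc d) (x : Sph d) : (sphMap L x : Euc d) = L x := rfl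

lemma continuous_sphMap (L : Euc d ≃ₗᵢ[ℝ] Euc d) : Continuous (sphMap L) :=
  Continuous.subtype_mk (L.continuous.comp continuous_subtype_val) _

open scoped Pointwise in
lemma measurePreserving_sphMap (L : Euc d ≃ₗᵢ[ℝ] Euc d) :
    MeasurePreserving (sphMap L) (sigma d) (sigma d) := by
  have key : MeasurePreserving (sphMap L) (volume : Measure (Euc d)).toSphere
      (volume : Measure (Euc d)).toSphere := by
    refine ⟨(continuous_sphMap L).measurable, ?_⟩
    ext s hs
    -- Up to a dimension factor, `toSphere` of a set is the volume of the cone over it in the unit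
    -- ball, and forming cones commutes with `L`.
    rw [Measure.map_apply (continuous_sphMap L).measurable hs, Measure.toSphere_apply' _ hs,
      Measure.toSphere_apply' _ ((continuous_sphMap L).measurable hs)]
    congr 1
    have hL : MeasurePreserving (L.toHomeomorph.toMeasurableEquiv) (volume : Measure (Euc d))
      volume := L.measurePreserving
    rw [← hL.measure_preimage_equiv (Set.Ioo (0 : ℝ) 1 • (((↑) : Sph d → Euc d) '' s))]
    congr 1
    ext y
    simp only [Set.mem_smul, Set.mem_image, Set.mem_preimage]
    constructor
    · rintro ⟨r, hr, _, ⟨x, hx, rfl⟩, rfl⟩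
      exact ⟨r, hr, _, ⟨_, hx, rfl⟩, by simp⟩
    · rintro ⟨r, hr, _, ⟨x, hx, rfl⟩, h⟩
      refine ⟨r, hr, _, ⟨sphMap L.symm x, ?_, rfl⟩, ?_⟩
      · have : sphMap L (sphMap L.symm x) = x := Subtype.ext (by simp)
        rwa [this]
      · apply L.injective
        simpa using h
  exact key.smul_measure _

lemma integral_sphMap (L : Euc d ≃ₗᵢ[ℝ] Euc d) {f : Sph d → ℝ} (hf : Measurable f) :
    ∫ x, f (sphMap L x) ∂(sigma d) = ∫ x, f x ∂(sigma d) := by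
  have h := measurePreserving_sphMap L
  rw [← integral_map (μ := sigma d) h.measurable.aemeasurable
    (by rw [h.map_eq]; exact hf.aestronglyMeasurable), h.map_eq]

/-- Points of equal norm are swapped by the reflection in the hyperplane orthogonal to `x - y`. -/
lemma exists_isometry_map_eq (x y : Sph d) :
    ∃ L : Euc d ≃ₗᵢ[ℝ] Euc d, L x = y :=
  ⟨_, Submodule.reflection_sub (by rw [norm_sph, norm_sph])⟩

lemma integral_inner_eq {f : ℝ → ℝ} (hf : Measurable f) (x y : Sph d) :
    ∫ z, f (inner ℝ (x : Euc d) (z : Euc d)) ∂(sigma d) =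
      ∫ z, f (inner ℝ (y : Euc d) (z : Euc d)) ∂(sigma d) := by
  obtain ⟨L, hL⟩ := exists_isometry_map_eq x y
  rw [← integral_sphMap L (f := fun z => f (inner ℝ (y : Euc d) (z : Euc d)))
    (hf.comp (by fun_prop))]
  simp only [coe_sphMap, ← hL, LinearIsometryEquiv.inner_map_map]

lemma norm_sub_sph (x y : Sph d) :
    ‖(x : Euc d) - y‖ = √(2 - 2 * inner ℝ (x : Euc d) (y : Euc d)) := by
  rw [eq_comm, Real.sqrt_eq_iff_eq_sq _ (norm_nonneg _), norm_sub_sq_real, norm_sph, norm_sph]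
  · ring
  · have := real_inner_le_norm (x : Euc d) (y : Euc d)
    rw [norm_sph, norm_sph] at this
    linarith

lemma integral_norm_sub_eq {f : ℝ → ℝ} (hf : Measurable f) (x y : Sph d) :
    ∫ z : Sph d, f ‖(x : Euc d) - z‖ ∂(sigma d) = ∫ z : Sph d, f ‖(y : Euc d) - z‖ ∂(sigma d) := by
  simp only [norm_sub_sph]
  exact integral_inner_eq (f := fun t => f √(2 - 2 * t)) (by fun_prop) x y

/-- The integrand is odd under the antipodal map. -/
lemma integral_inner_eq_zero (v : Euc d) :
    ∫ x : Sph d, inner ℝ v (x : Euc d) ∂(sigma d) = 0 := by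
  have := integral_sphMap (d := d) (LinearIsometryEquiv.neg ℝ)
    (f := fun x => inner ℝ v (x : Euc d)) (by fun_prop)
  simp only [coe_sphMap, LinearIsometryEquiv.coe_neg, inner_neg_right, integral_neg] at this
  linarith

end Rotation

/-! ### Mean square deviation for a kernel given by a feature map. -/

section Kernel

variable {W Y : Type*} [MeasurableSpace W] [MeasurableSpace Y]

/-- If `K(y, z) = ∫ φ(w, y) φ(w, z) dρ(w)` has constant mean `m` in the second variable, the mean
square deviation of an empirical mean of `φ` from its integral is the average of `K` minus `m`. -/
lemma integral_sq_empirical_sub {N : ℕ} (hN : N ≠ 0) (p : Fin N → Y)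
    (ρ : Measure W) [IsFiniteMeasure ρ] (σ : Measure Y) [IsProbabilityMeasure σ]
    {φ : W → Y → ℝ} (hφ : Measurable (Function.uncurry φ)) {C : ℝ} (hC : ∀ w y, |φ w y| ≤ C)
    {m : ℝ} (hm : ∀ y, ∫ z, ∫ w, φ w y * φ w z ∂ρ ∂σ = m) :
    ∫ w, ((∑ k, φ w (p k)) / N - ∫ y, φ w y ∂σ) ^ 2 ∂ρ =
      (∑ j, ∑ k, ∫ w, φ w (p j) * φ w (p k) ∂ρ) / (N : ℝ) ^ 2 - m := by
  have hN' : (N : ℝ) ≠ 0 := by exact_mod_cast hN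
  have hφ1 (y : Y) : Measurable fun w => φ w y := hφ.comp (measurable_id.prodMk measurable_const)
  have hφ2 : StronglyMeasurable fun w => ∫ y, φ w y ∂σ :=
    StronglyMeasurable.integral_prod_right (f := φ) hφ.stronglyMeasurable
  have hb (w : W) : |∫ y, φ w y ∂σ| ≤ C := by
    have := norm_integral_le_of_norm_le_const (μ := σ) (f := φ w) (C := C)
      (Filter.Eventually.of_forall fun y => hC w y)
    simpa using this
  have hCC {a b : ℝ} (ha : |a| ≤ C) (hb : |b| ≤ C) : ‖a * b‖ ≤ C * C := by
    rw [Real.norm_eq_abs, abs_mul]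
    exact mul_le_mul ha hb (abs_nonneg _) ((abs_nonneg _).trans ha)
  have i1 (j k : Fin N) : Integrable (fun w => φ w (p j) * φ w (p k)) ρ :=
    Integrable.of_bound ((hφ1 _).mul (hφ1 _)).aestronglyMeasurable (C * C)
      (Filter.Eventually.of_forall fun w => hCC (hC _ _) (hC _ _))
  have i2 (j : Fin N) : Integrable (fun w => φ w (p j) * ∫ y, φ w y ∂σ) ρ :=
    Integrable.of_bound ((hφ1 _).mul hφ2.measurable).aestronglyMeasurable (C * C)
      (Filter.Eventually.of_forall fun w => hCC (hC _ _) (hb _))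
  have i3 : Integrable (fun w => (∫ y, φ w y ∂σ) * ∫ y, φ w y ∂σ) ρ :=
    Integrable.of_bound (hφ2.measurable.mul hφ2.measurable).aestronglyMeasurable (C * C)
      (Filter.Eventually.of_forall fun w => hCC (hb _) (hb _))
  -- By Fubini each cross term integrates to `m`, and averaging over `y` gives the same for the
  -- squared mean. The expanded square then contributes `-2m + m = -m`.
  have e2 (y : Y) : ∫ w, φ w y * ∫ z, φ w z ∂σ ∂ρ = m := by
    rw [← hm y, ← integral_integral_swap]
    · simp only [integral_const_mul]
    · exact Integrable.of_bound (((hφ1 y).comp measurable_fst).mul hφ).aestronglyMeasurable (C * C)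
        (Filter.Eventually.of_forall fun w => hCC (hC _ _) (hC _ _))
  have e3 : ∫ w, (∫ y, φ w y ∂σ) * ∫ z, φ w z ∂σ ∂ρ = m := by
    have : ∫ y, ∫ w, φ w y * ∫ z, φ w z ∂σ ∂ρ ∂σ = m := by simp [e2]
    rw [← this, ← integral_integral_swap]
    · simp only [integral_mul_const]
    · exact Integrable.of_bound (hφ.mul (hφ2.measurable.comp measurable_fst)).aestronglyMeasurable
        (C * C) (Filter.Eventually.of_forall fun w => hCC (hC _ _) (hb _))
  have expand (w : W) : ((∑ k, φ w (p k)) / N - ∫ y, φ w y ∂σ) ^ 2 =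
      (∑ j, ∑ k, φ w (p j) * φ w (p k)) / (N : ℝ) ^ 2 -
        (2 / N) * (∑ j, φ w (p j) * ∫ y, φ w y ∂σ) + (∫ y, φ w y ∂σ) * ∫ y, φ w y ∂σ := by
    rw [← Finset.sum_mul, ← Finset.sum_mul_sum]
    ring
  simp only [expand]
  have s1 : Integrable (fun w => ∑ j, ∑ k, φ w (p j) * φ w (p k)) ρ :=
    integrable_finsetSum _ fun j _ => integrable_finsetSum _ fun k _ => i1 j k
  have s2 : Integrable (fun w => ∑ j, φ w (p j) * ∫ y, φ w y ∂σ) ρ :=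
    integrable_finsetSum _ fun j _ => i2 j
  have s3 : Integrable (fun w => (∑ j, ∑ k, φ w (p j) * φ w (p k)) / (N : ℝ) ^ 2 -
      (2 / N) * ∑ j, φ w (p j) * ∫ y, φ w y ∂σ) ρ := (s1.div_const _).sub (s2.const_mul _)
  rw [integral_add s3 i3,
    integral_sub (s1.div_const _) (s2.const_mul _), integral_div, integral_const_mul,
    integral_finsetSum _ fun j _ => integrable_finsetSum _ fun k _ => i1 j k,
    integral_finsetSum _ fun j _ => i2 j, e3]
  simp only [e2, Finset.sum_const, Finset.card_univ, Fintype.card_fin, nsmul_eq_mul]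
  rw [Finset.sum_congr rfl fun j _ => integral_finsetSum _ fun k _ => i1 j k]
  field_simp
  ring

end Kernel

/-! ### The mean of `|⟨v, x⟩|` over the sphere. -/

section AbsInner

lemma integral_abs_mul_exp_neg_sq : ∫ t : ℝ, |t| * Real.exp (-t ^ 2) = 1 := by
  have h := integral_comp_abs (f := fun t => t * Real.exp (-t ^ 2))
  simp only [sq_abs] at h
  have h1 := integral_pow_mul_exp_neg_sq 1
  norm_num at h1
  rw [h, h1]
  norm_num

lemma integral_exp_neg_sq : ∫ t : ℝ, Real.exp (-t ^ 2) = √Real.pi := by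
  have h := integral_gaussian 1
  simpa using h

/-- The integrand is a product over coordinates: coordinate `0` contributes `1`, each of the other
`d` contributes `√π`. -/
lemma integral_abs_coord_mul_exp (d : ℕ) :
    ∫ y : Euc d, |y 0| * Real.exp (-‖y‖ ^ 2) = √Real.pi ^ d := by
  have h := (EuclideanSpace.volume_preserving_symm_measurableEquiv_toLp (Fin (d + 1))).integral_comp
    (MeasurableEquiv.measurableEmbedding _)
    (fun x : Fin (d + 1) → ℝ => ∏ i, (if i = 0 then |x i| else 1) * Real.exp (-(x i) ^ 2))
  rw [integral_fintype_prod_volume_eq_prod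
    (f := fun i (t : ℝ) => (if i = 0 then |t| else 1) * Real.exp (-t ^ 2)),
    Fin.prod_univ_succ] at h
  simp only [if_true, Fin.succ_ne_zero, if_false, one_mul, integral_abs_mul_exp_neg_sq,
    integral_exp_neg_sq, Finset.prod_const, Finset.card_univ, Fintype.card_fin] at h
  rw [← h]
  congr 1
  ext y
  rw [Finset.prod_mul_distrib, ← Real.exp_sum, EuclideanSpace.real_norm_sq_eq]
  simp

/-- In polar coordinates the preceding Gaussian integral is the wanted mean times the area and a
radial Gamma integral; `area_mul_Gamma` eliminates the area. -/
lemma integral_abs_inner_coord (d : ℕ) (hd : d ≠ 0) :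
    ∫ x : Sph d, |(x : Euc d) 0| ∂(sigma d) = 2 * Cconst d := by
  have h := integral_abs_coord_mul_exp d
  rw [integral_polar] at h
  have h2 := integral_sphere_prod (d := d) (fun x => |(x : Euc d) 0|)
    (fun r => r * Real.exp (-r ^ 2))
  have h3 := integral_pow_mul_exp_neg_sq (d + 1)
  simp only [pow_succ _ d, mul_assoc] at h3
  rw [h3] at h2
  have h4 : ∫ p : Sph d × Set.Ioi (0 : ℝ), |((p.2 : ℝ) • (p.1 : Euc d)) 0| *
      Real.exp (-‖(p.2 : ℝ) • (p.1 : Euc d)‖ ^ 2)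
      ∂((volume : Measure (Euc d)).toSphere.prod (Measure.volumeIoiPow d)) =
      ∫ p : Sph d × Set.Ioi (0 : ℝ), |(p.1 : Euc d) 0| * ((p.2 : ℝ) * Real.exp (-(p.2 : ℝ) ^ 2))
      ∂((volume : Measure (Euc d)).toSphere.prod (Measure.volumeIoiPow d)) := by
    congr 1
    ext p
    rw [norm_smul, norm_sph, mul_one, Real.norm_eq_abs, sq_abs]
    simp only [PiLp.smul_apply, smul_eq_mul, abs_mul, abs_of_pos p.2.2.out]
    ring
  rw [h4, h2] at h
  have ha := area_mul_Gamma d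
  have hd0 : (0 : ℝ) < d := by positivity
  have hg1 : 0 < Real.Gamma (((d : ℝ) + 1) / 2) := Real.Gamma_pos_of_pos (by positivity)
  have hg2 : 0 < Real.Gamma ((d : ℝ) / 2) := Real.Gamma_pos_of_pos (by positivity)
  have hG : Real.Gamma ((((d + 1 : ℕ) : ℝ) + 1) / 2) = d / 2 * Real.Gamma ((d : ℝ) / 2) := by
    rw [← Real.Gamma_add_one (by positivity)]
    congr 1
    push_cast
    ring
  have hpi : Real.pi ^ (((d : ℝ) + 1) / 2) = √Real.pi ^ d * √Real.pi := by
    rw [← pow_succ, Real.sqrt_eq_rpow, ← Real.rpow_natCast, ← Real.rpow_mul Real.pi_pos.le]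
    congr 1
    push_cast
    ring
  rw [hG] at h
  rw [hpi, ← h] at ha
  have hA := area_pos d
  have hsp : 0 < √Real.pi := Real.sqrt_pos.2 Real.pi_pos
  unfold Cconst
  set G1 := Real.Gamma (((d : ℝ) + 1) / 2)
  set G2 := Real.Gamma ((d : ℝ) / 2)
  set c := ∫ x : Sph d, |(x : Euc d) 0| ∂(sigma d)
  have hc : G1 / 2 = c * (d / 2 * G2 / 2) * √Real.pi := by
    apply mul_left_cancel₀ hA.ne'
    rw [ha]
    ring
  field_simp
  linarith

lemma integral_abs_inner {d : ℕ} (hd : d ≠ 0) (v : Euc d) :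
    ∫ x : Sph d, |inner ℝ v (x : Euc d)| ∂(sigma d) = 2 * Cconst d * ‖v‖ := by
  rcases eq_or_ne v 0 with rfl | hv
  · simp
  have hv' : ‖v‖ ≠ 0 := norm_ne_zero_iff.2 hv
  let u : Sph d := ⟨‖v‖⁻¹ • v, by simp [norm_smul, hv']⟩
  let e : Sph d := ⟨EuclideanSpace.single 0 1, by simp⟩
  have hvu : v = ‖v‖ • (u : Euc d) := by simp [u, smul_smul, hv']
  have h1 (x : Sph d) : |inner ℝ v (x : Euc d)| = ‖v‖ * |inner ℝ (u : Euc d) (x : Euc d)| := by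
    conv_lhs => rw [hvu]
    rw [real_inner_smul_left, abs_mul, abs_norm]
  simp only [h1]
  rw [integral_const_mul, integral_inner_eq (f := fun t => |t|) (by fun_prop) u e,
    ← integral_abs_inner_coord d hd, mul_comm]
  congr 2
  ext x
  simp [e, EuclideanSpace.inner_single_left]

end AbsInner

/-! ### Stolarsky's invariance principle. -/

section Stolarsky

variable {d : ℕ}

/-- The indicator function of the cap with centre `w.1` and height `w.2`. -/
noncomputable def capIndicator (w : Sph d × ℝ) (y : Sph d) : ℝ :=
  (cap w.1 w.2).indicator 1 y

lemma measurableSet_cap (x : Sph d) (t : ℝ) : MeasurableSet (cap x t) :=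
  measurableSet_le measurable_const (by fun_prop)

lemma measurable_capIndicator : Measurable (Function.uncurry (capIndicator (d := d))) := by
  have hs : MeasurableSet {q : (Sph d × ℝ) × Sph d |
      q.1.2 ≤ inner ℝ (q.2 : Euc d) (q.1.1 : Euc d)} :=
    measurableSet_le (by fun_prop) (by fun_prop)
  exact (measurable_const (a := (1 : ℝ))).indicator hs

lemma abs_capIndicator_le (w : Sph d × ℝ) (y : Sph d) : |capIndicator w y| ≤ 1 := by
  by_cases h : y ∈ cap w.1 w.2 <;> simp [capIndicator, h]

lemma integral_capIndicator (w : Sph d × ℝ) :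
    ∫ y, capIndicator w y ∂(sigma d) = (sigma d).real (cap w.1 w.2) := by
  simp only [capIndicator]
  exact integral_indicator_one (measurableSet_cap _ _)

lemma ncard_eq_sum_capIndicator {N : ℕ} (p : Fin N → Sph d) (w : Sph d × ℝ) :
    (({k : Fin N | p k ∈ cap w.1 w.2}.ncard : ℕ) : ℝ) = ∑ k, capIndicator w (p k) := by
  classical
  simp only [capIndicator, Set.indicator_apply, Pi.one_apply, Finset.sum_boole]
  rw [Set.ncard_eq_toFinset_card']
  simp

/-- The measure on centres and heights in the definition of the discrepancy. -/
noncomputable def capMeasure (d : ℕ) : Measure (Sph d × ℝ) :=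
  (sigma d).prod (volume.restrict (Set.Ioc (-1) 1))

instance (d : ℕ) : IsFiniteMeasure (capMeasure d) := by
  unfold capMeasure
  infer_instance

lemma abs_inner_sph_le (x y : Sph d) : |inner ℝ (x : Euc d) (y : Euc d)| ≤ 1 := by
  simpa [norm_sph] using abs_real_inner_le_norm (x : Euc d) (y : Euc d)

/-- For a fixed centre `x`, both points lie in the cap exactly when `t ≤ min a b`, with `a = ⟨y, x⟩`
and `b = ⟨z, x⟩`. This is a set of heights of length `1 + (a + b)/2 - |a - b|/2`. Averaging over `x`
kills the linear part, and the last term gives `C_d ‖y - z‖`. -/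
lemma integral_capIndicator_mul (hd : d ≠ 0) (y z : Sph d) :
    ∫ w, capIndicator w y * capIndicator w z ∂(capMeasure d) =
      1 - Cconst d * ‖(y : Euc d) - z‖ := by
  have hm (y : Sph d) : Measurable fun w => capIndicator w y :=
    measurable_capIndicator.comp (measurable_id.prodMk measurable_const)
  rw [capMeasure, integral_prod]
  swap
  · refine Integrable.of_bound ((hm y).mul (hm z)).aestronglyMeasurable 1
      (Filter.Eventually.of_forall fun w => ?_)
    rw [Real.norm_eq_abs, abs_mul]
    exact mul_le_one₀ (abs_capIndicator_le _ _) (abs_nonneg _) (abs_capIndicator_le _ _)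
  have inner_int (x : Sph d) :
      ∫ t in Set.Ioc (-1 : ℝ) 1, capIndicator (x, t) y * capIndicator (x, t) z =
      1 + ((1 / 2) * inner ℝ ((y : Euc d) + z) (x : Euc d) -
        (1 / 2) * |inner ℝ ((y : Euc d) - z) (x : Euc d)|) := by
    set a := inner ℝ (y : Euc d) (x : Euc d) with ha
    set b := inner ℝ (z : Euc d) (x : Euc d) with hb
    have e : ∀ t, capIndicator (x, t) y * capIndicator (x, t) z =
        (Set.Iic (min a b)).indicator 1 t := by
      intro t
      by_cases h1 : t ≤ a <;> by_cases h2 : t ≤ b <;>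
        simp [capIndicator, cap, ← ha, ← hb, h1, h2]
    simp only [e]
    rw [integral_indicator_one measurableSet_Iic, measureReal_restrict_apply measurableSet_Iic]
    have ha1 := abs_le.1 (abs_inner_sph_le y x)
    have hb1 := abs_le.1 (abs_inner_sph_le z x)
    have hmin : min a b ≤ 1 := (min_le_left _ _).trans ha1.2
    have hmin' : -1 ≤ min a b := le_min ha1.1 hb1.1
    have : Set.Iic (min a b) ∩ Set.Ioc (-1) 1 = Set.Ioc (-1) (min a b) := by
      ext t
      simp only [Set.mem_inter_iff, Set.mem_Iic, Set.mem_Ioc]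
      constructor
      · rintro ⟨h1, h2, h3⟩
        exact ⟨h2, h1⟩
      · rintro ⟨h1, h2⟩
        exact ⟨h2, h1, h2.trans hmin⟩
    rw [this, Real.volume_real_Ioc_of_le hmin', inner_add_left, inner_sub_left, ← ha, ← hb]
    rcases le_total a b with hab | hab
    · rw [min_eq_left hab, abs_of_nonpos (by linarith)]
      ring
    · rw [min_eq_right hab, abs_of_nonneg (by linarith)]
      ring
  simp only [inner_int]
  have i1 : Integrable (fun x : Sph d => inner ℝ ((y : Euc d) + z) (x : Euc d)) (sigma d) :=
    Continuous.integrable_of_hasCompactSupport (by fun_prop) (HasCompactSupport.of_compactSpace _)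
  have i2 : Integrable (fun x : Sph d => |inner ℝ ((y : Euc d) - z) (x : Euc d)|) (sigma d) :=
    Continuous.integrable_of_hasCompactSupport (by fun_prop) (HasCompactSupport.of_compactSpace _)
  have i3 : Integrable (fun x : Sph d => 1 / 2 * inner ℝ ((y : Euc d) + z) (x : Euc d) -
      1 / 2 * |inner ℝ ((y : Euc d) - z) (x : Euc d)|) (sigma d) :=
    (i1.const_mul _).sub (i2.const_mul _)
  rw [integral_add (integrable_const _) i3, integral_sub (i1.const_mul _) (i2.const_mul _),
    integral_const_mul, integral_const_mul, integral_inner_eq_zero, integral_abs_inner hd]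
  simp
  ring

/-- Stolarsky's invariance principle. -/
theorem discrepancy_eq (hd : d ≠ 0) {N : ℕ} (hN : N ≠ 0) (p : Fin N → Sph d) (e : Sph d) :
    discrepancy p = √(Cconst d * (∫ y : Sph d, ‖(e : Euc d) - y‖ ∂(sigma d) -
      (∑ j, ∑ k, ‖(p j : Euc d) - p k‖) / (N : ℝ) ^ 2)) := by
  have hmean (y : Sph d) : ∫ z, ∫ w, capIndicator w y * capIndicator w z ∂(capMeasure d) ∂(sigma d)
      = 1 - Cconst d * ∫ y : Sph d, ‖(e : Euc d) - y‖ ∂(sigma d) := by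
    simp only [integral_capIndicator_mul hd]
    rw [integral_sub (integrable_const _), integral_const_mul,
      integral_norm_sub_eq (f := fun t => t) measurable_id y e]
    · simp
    · exact Continuous.integrable_of_hasCompactSupport (by fun_prop)
        (HasCompactSupport.of_compactSpace _)
  have h := integral_sq_empirical_sub hN p (capMeasure d) (sigma d) measurable_capIndicator
    abs_capIndicator_le hmean
  unfold discrepancy
  congr 1
  have hN' : (N : ℝ) ≠ 0 := by exact_mod_cast hN
  have hrhs : Cconst d * (∫ y : Sph d, ‖(e : Euc d) - y‖ ∂(sigma d) -
      (∑ j, ∑ k, ‖(p j : Euc d) - p k‖) / (N : ℝ) ^ 2) =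
      (∑ j, ∑ k, ∫ w, capIndicator w (p j) * capIndicator w (p k) ∂(capMeasure d)) / (N : ℝ) ^ 2 -
      (1 - Cconst d * ∫ y : Sph d, ‖(e : Euc d) - y‖ ∂(sigma d)) := by
    simp only [integral_capIndicator_mul hd, Finset.sum_sub_distrib, Finset.sum_const,
      Finset.card_univ, Fintype.card_fin, nsmul_eq_mul, mul_one, ← Finset.mul_sum]
    field_simp
    ring
  rw [hrhs, ← h, intervalIntegral.integral_of_le (by norm_num), capMeasure, integral_prod_symm]
  · simp only [ncard_eq_sum_capIndicator p (_, _), integral_capIndicator, sq_abs]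
  · have hm : Measurable fun w => (∑ k, capIndicator w (p k)) / N - ∫ y, capIndicator w y ∂(sigma d) := by
      refine Measurable.sub (Measurable.div_const (Finset.measurable_sum _ fun k _ =>
        measurable_capIndicator.comp (measurable_id.prodMk measurable_const)) _) ?_
      exact (StronglyMeasurable.integral_prod_right (f := capIndicator)
        measurable_capIndicator.stronglyMeasurable).measurable
    refine Integrable.of_bound (hm.pow_const 2).aestronglyMeasurable 4
      (Filter.Eventually.of_forall fun w => ?_)
    have b1 : |(∑ k, capIndicator w (p k)) / (N : ℝ)| ≤ 1 := by
      rw [abs_div, Nat.abs_cast, div_le_one (by positivity)]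
      refine (Finset.abs_sum_le_sum_abs _ _).trans
        ((Finset.sum_le_sum fun k _ => abs_capIndicator_le w (p k)).trans ?_)
      simp
    have b2 : |∫ y, capIndicator w y ∂(sigma d)| ≤ 1 := by
      rw [integral_capIndicator, abs_of_nonneg measureReal_nonneg]
      exact measureReal_le_one
    rw [Real.norm_eq_abs, abs_pow, sq_abs]
    have b3 := abs_le.1 b1
    have b4 := abs_le.1 b2
    nlinarith

end Stolarsky

/-! ### Positive definiteness of the Gaussian kernel. -/

section GaussianKernel

variable {d : ℕ}

lemma integral_cos_inner_stdGaussian (t : Euc d) :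
    ∫ w, Real.cos (inner ℝ w t) ∂(ProbabilityTheory.stdGaussian (Euc d)) =
      Real.exp (-‖t‖ ^ 2 / 2) ∧
    ∫ w, Real.sin (inner ℝ w t) ∂(ProbabilityTheory.stdGaussian (Euc d)) = 0 := by
  have h := ProbabilityTheory.charFun_stdGaussian t
  rw [charFun_apply] at h
  have hi : Integrable (fun w : Euc d => Complex.exp (inner ℝ w t * Complex.I))
      (ProbabilityTheory.stdGaussian (Euc d)) :=
    Integrable.of_bound (by fun_prop) 1
      (Filter.Eventually.of_forall fun w => (Complex.norm_exp_ofReal_mul_I _).le)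
  have h' : (∫ w, Complex.exp (inner ℝ w t * Complex.I)
      ∂(ProbabilityTheory.stdGaussian (Euc d))) = ((Real.exp (-‖t‖ ^ 2 / 2) : ℝ) : ℂ) := by
    rw [h]
    push_cast
    rfl
  have hre := Complex.reCLM.integral_comp_comm hi
  have him := Complex.imCLM.integral_comp_comm hi
  rw [h'] at hre him
  simp only [Complex.reCLM_apply, Complex.imCLM_apply, Complex.exp_ofReal_mul_I_re,
    Complex.exp_ofReal_mul_I_im, Complex.ofReal_re, Complex.ofReal_im] at hre him
  exact ⟨hre, him⟩

/-- The kernel of the Hartley transform. -/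
noncomputable def hartley (s : ℝ) (w : Euc d) (y : Sph d) : ℝ :=
  Real.cos (√(2 * s) * inner ℝ w (y : Euc d)) + Real.sin (√(2 * s) * inner ℝ w (y : Euc d))

/-- `(cos α + sin α)(cos β + sin β) = cos(α - β) + sin(α + β)`. Under the standard Gaussian the sine
integrates to zero and the cosine gives the characteristic function `exp(-‖t‖²/2)`; the factor
`√(2s)` turns this into the kernel with parameter `s`. -/
lemma integral_hartley_mul {s : ℝ} (hs : 0 ≤ s) (y z : Sph d) :
    ∫ w, hartley s w y * hartley s w z ∂(ProbabilityTheory.stdGaussian (Euc d)) =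
      Real.exp (-s * ‖(y : Euc d) - z‖ ^ 2) := by
  have h1 := (integral_cos_inner_stdGaussian (√(2 * s) • ((y : Euc d) - (z : Euc d)))).1
  have h2 := (integral_cos_inner_stdGaussian (√(2 * s) • ((y : Euc d) + (z : Euc d)))).2
  have e (w : Euc d) : hartley s w y * hartley s w z =
      Real.cos (inner ℝ w (√(2 * s) • ((y : Euc d) - (z : Euc d)))) +
      Real.sin (inner ℝ w (√(2 * s) • ((y : Euc d) + (z : Euc d)))) := by
    rw [inner_smul_right, inner_smul_right, inner_sub_right, inner_add_right, mul_sub, mul_add,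
      Real.cos_sub, Real.sin_add, hartley, hartley]
    ring
  simp only [e]
  rw [integral_add, h1, h2, add_zero, norm_smul, mul_pow, Real.norm_eq_abs, sq_abs,
    Real.sq_sqrt (by positivity)]
  · congr 1
    ring
  · exact Integrable.of_bound (by fun_prop) 1
      (Filter.Eventually.of_forall fun w => Real.abs_cos_le_one _)
  · exact Integrable.of_bound (by fun_prop) 1
      (Filter.Eventually.of_forall fun w => Real.abs_sin_le_one _)

/-- The Gaussian energy of a finite set of points is at least that of the uniform measure. -/
theorem gaussian_energy_nonneg {N : ℕ} (hN : N ≠ 0) (p : Fin N → Sph d) (e : Sph d) {s : ℝ}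
    (hs : 0 ≤ s) :
    0 ≤ (∑ j, ∑ k, Real.exp (-s * ‖(p j : Euc d) - p k‖ ^ 2)) / (N : ℝ) ^ 2 -
      ∫ y : Sph d, Real.exp (-s * ‖(e : Euc d) - y‖ ^ 2) ∂(sigma d) := by
  have hmean (y : Sph d) : ∫ z, ∫ w, hartley s w y * hartley s w z
      ∂(ProbabilityTheory.stdGaussian (Euc d)) ∂(sigma d) =
      ∫ y : Sph d, Real.exp (-s * ‖(e : Euc d) - y‖ ^ 2) ∂(sigma d) := by
    simp only [integral_hartley_mul hs]
    exact integral_norm_sub_eq (f := fun t => Real.exp (-s * t ^ 2)) (by fun_prop) y e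
  have h := integral_sq_empirical_sub hN p (ProbabilityTheory.stdGaussian (Euc d)) (sigma d)
    (φ := hartley s) (C := 2) (by unfold hartley Function.uncurry; fun_prop) (fun w y => by
      refine (abs_add_le _ _).trans ?_
      linarith [Real.abs_cos_le_one (√(2 * s) * inner ℝ w (y : Euc d)),
        Real.abs_sin_le_one (√(2 * s) * inner ℝ w (y : Euc d))]) hmean
  simp only [integral_hartley_mul hs] at h
  rw [← h]
  exact integral_nonneg fun w => sq_nonneg _

end GaussianKernel

/-! ### Decay of the mean of the Gaussian kernel. -/

section GaussianMean

variable {d : ℕ}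

lemma norm_smul_sub_sq (r : ℝ) (x e : Sph d) :
    ‖r • (x : Euc d) - e‖ ^ 2 = (r - 1) ^ 2 + r * ‖(x : Euc d) - e‖ ^ 2 := by
  rw [norm_sub_sq_real, norm_sub_sq_real, norm_smul, norm_sph, norm_sph, real_inner_smul_left,
    Real.norm_eq_abs, mul_one, sq_abs]
  ring

lemma integral_pow_mul_indicator (n : ℕ) {a c : ℝ} (ha : 0 ≤ a) :
    ∫ r in Set.Ioi (0 : ℝ), r ^ n * (Set.Ioc 1 (1 + a)).indicator (fun r => c / r ^ n) r =
      c * a := by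
  have e : ∀ r ∈ Set.Ioi (0 : ℝ), r ^ n * (Set.Ioc 1 (1 + a)).indicator (fun r => c / r ^ n) r =
      (Set.Ioc 1 (1 + a)).indicator (fun _ => c) r := by
    intro r hr
    by_cases h : r ∈ Set.Ioc 1 (1 + a)
    · simp only [Set.indicator_of_mem h]
      have := hr.out.ne'
      field_simp
    · simp only [Set.indicator_of_notMem h, mul_zero]
  rw [setIntegral_congr_fun measurableSet_Ioi e, setIntegral_indicator measurableSet_Ioc,
    Set.inter_eq_right.2 (show Set.Ioc 1 (1 + a) ⊆ Set.Ioi 0 from fun r hr => lt_trans one_pos hr.1), setIntegral_const,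
    Real.volume_real_Ioc_of_le (by linarith), smul_eq_mul]
  ring

lemma integrable_exp_neg_mul_norm_sub_sq (e : Euc d) {s : ℝ} (hs : 0 < s) :
    Integrable fun y : Euc d => Real.exp (-s * ‖y - e‖ ^ 2) := by
  have h : Integrable fun y : Euc d => Real.exp (-s * ‖y‖ ^ 2) := by
    -- A non-integrable function has integral `0` by convention, whereas the closed form is
    -- positive.
    by_contra hc
    have := GaussianFourier.integral_rexp_neg_mul_sq_norm (V := Euc d) hs
    rw [integral_undef hc] at this
    have hp : 0 < (Real.pi / s) ^ ((Module.finrank ℝ (Euc d) : ℝ) / 2) := by positivity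
    exact hp.ne this
  exact h.comp_sub_right e

/-- The spherical mean is compared with a full Gaussian integral centred at `e`. On the shell `1 < r
≤ 1 + 1/√s` one has `s‖r x - e‖² = s(r-1)² + s r‖x - e‖² ≤ 1 + 2s‖x - e‖²`, so thickening the sphere
costs only a factor `e`, and the shell has thickness `s^(-1/2)`. -/
lemma gaussian_mean_le_of_one_le (e : Sph d) {s : ℝ} (hs : 1 ≤ s) :
    ∫ y : Sph d, Real.exp (-(2 * s) * ‖(e : Euc d) - y‖ ^ 2) ∂(sigma d) ≤
      Real.exp 1 / 2 * Real.Gamma (((d : ℝ) + 1) / 2) * s ^ (-(d : ℝ) / 2) := by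
  have hs0 : 0 < s := by linarith
  set m := ∫ y : Sph d, Real.exp (-(2 * s) * ‖(e : Euc d) - y‖ ^ 2) ∂(sigma d) with hm
  have hint := integrable_exp_neg_mul_norm_sub_sq (e : Euc d) hs0
  have h1 : ∫ y : Euc d, Real.exp (-s * ‖y - e‖ ^ 2) = (Real.pi / s) ^ (((d : ℝ) + 1) / 2) := by
    rw [integral_sub_right_eq_self (fun y : Euc d => Real.exp (-s * ‖y‖ ^ 2)) (e : Euc d),
      GaussianFourier.integral_rexp_neg_mul_sq_norm hs0]
    simp
  have h2 := integral_sphere_prod (d := d)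
    (fun x => Real.exp (-(2 * s) * ‖(e : Euc d) - x‖ ^ 2))
    -- The weight `1 / r ^ d` cancels the polar Jacobian and is at most `1` on the shell.
    (fun r => (Set.Ioc 1 (1 + 1 / √s)).indicator (fun r => Real.exp (-1) / r ^ d) r)
  rw [integral_pow_mul_indicator d (by positivity), ← hm] at h2
  have h3 : area d * m * (Real.exp (-1) * (1 / √s)) ≤ (Real.pi / s) ^ (((d : ℝ) + 1) / 2) := by
    rw [← h1, ← h2, integral_polar]
    refine integral_mono_of_nonneg (Filter.Eventually.of_forall fun q => ?_)
      (integrable_polar hint) (Filter.Eventually.of_forall fun q => ?_)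
    · exact mul_nonneg (Real.exp_pos _).le
        (Set.indicator_nonneg (fun r hr => by have := hr.1; positivity) _)
    · simp only
      by_cases hq : (q.2 : ℝ) ∈ Set.Ioc 1 (1 + 1 / √s)
      · rw [Set.indicator_of_mem hq]
        set r : ℝ := (q.2 : ℝ)
        have hr1 : 1 ≤ r := hq.1.le
        have hsq : 0 < √s := Real.sqrt_pos.2 hs0
        have hsq1 : 1 ≤ √s := Real.one_le_sqrt.2 hs
        have hr2 : r - 1 ≤ 1 / √s := by linarith [hq.2]
        have hr3 : r ≤ 2 := by
          have : 1 / √s ≤ 1 := by rwa [div_le_one hsq]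
          linarith
        have hr4 : s * (r - 1) ^ 2 ≤ 1 := by
          calc s * (r - 1) ^ 2 ≤ s * (1 / √s) ^ 2 := by
                gcongr
            _ = 1 := by
                rw [div_pow, Real.sq_sqrt hs0.le]
                field_simp
        calc Real.exp (-(2 * s) * ‖(e : Euc d) - q.1‖ ^ 2) * (Real.exp (-1) / r ^ d)
            ≤ Real.exp (-(2 * s) * ‖(e : Euc d) - q.1‖ ^ 2) * Real.exp (-1) := by
              gcongr
              exact div_le_self (Real.exp_pos _).le (one_le_pow₀ hr1)
          _ = Real.exp (-(2 * s) * ‖(e : Euc d) - q.1‖ ^ 2 + -1) := (Real.exp_add _ _).symm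
          _ ≤ Real.exp (-s * ‖r • (q.1 : Euc d) - e‖ ^ 2) := by
              rw [Real.exp_le_exp, norm_smul_sub_sq, norm_sub_rev (e : Euc d)]
              have : r * (s * ‖(q.1 : Euc d) - e‖ ^ 2) ≤ 2 * (s * ‖(q.1 : Euc d) - e‖ ^ 2) := by
                gcongr
              linarith
      · rw [Set.indicator_of_notMem hq, mul_zero]
        exact (Real.exp_pos _).le
  rw [Real.div_rpow Real.pi_pos.le hs0.le, ← area_mul_Gamma, mul_assoc, mul_div_assoc] at h3
  have h4 := le_of_mul_le_mul_left h3 (area_pos d)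
  have hpow : s ^ (((d : ℝ) + 1) / 2) = s ^ ((d : ℝ) / 2) * √s := by
    rw [Real.sqrt_eq_rpow, ← Real.rpow_add hs0]
    congr 1
    ring
  rw [hpow] at h4
  rw [neg_div, Real.rpow_neg hs0.le]
  have hsq : 0 < √s := Real.sqrt_pos.2 hs0
  have hp : 0 < s ^ ((d : ℝ) / 2) := by positivity
  rw [Real.exp_neg] at h4
  have he := Real.exp_pos 1
  have h5 := mul_le_mul_of_nonneg_right h4 (mul_pos he hsq).le
  field_simp at h5 ⊢
  linarith

/-- The constant in the bound `A_d s^(-d/2)` for the mean of the Gaussian kernel. -/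
noncomputable def gaussConst (d : ℕ) : ℝ :=
  2 ^ d * (Real.Gamma (((d : ℝ) + 3) / 2) / Real.Gamma (3 / 2))

lemma Gamma_three_halves : Real.Gamma (3 / 2) = √Real.pi / 2 := by
  have h := Real.Gamma_add_one (s := 1 / 2) (by norm_num)
  rw [Real.Gamma_one_half_eq] at h
  norm_num at h
  rw [h]
  ring

lemma Gamma_three_halves_lt_one : Real.Gamma (3 / 2) < 1 := by
  rw [Gamma_three_halves, div_lt_one two_pos, Real.sqrt_lt' two_pos]
  linarith [Real.pi_lt_four]

lemma Gamma_three_halves_pos : 0 < Real.Gamma (3 / 2) := Real.Gamma_pos_of_pos (by norm_num)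

/-- Ensures that the cut-off `(A N)^(2/d)` is at least `4`, inside the range `s ≥ 2` of
`gaussian_mean_le`. -/
lemma two_pow_le_gaussConst (hd : 2 ≤ d) : 2 ^ d ≤ gaussConst d := by
  have hd' : (2 : ℝ) ≤ d := by exact_mod_cast hd
  have h1 : 1 ≤ Real.Gamma (((d : ℝ) + 3) / 2) := by
    rw [← Real.Gamma_two]
    exact Real.Gamma_strictMonoOn_Ici.monotoneOn Set.self_mem_Ici
      (show (2 : ℝ) ≤ ((d : ℝ) + 3) / 2 by linarith) (by linarith)
  have h2 : 1 ≤ Real.Gamma (((d : ℝ) + 3) / 2) / Real.Gamma (3 / 2) := by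
    rw [one_le_div Gamma_three_halves_pos]
    exact Gamma_three_halves_lt_one.le.trans h1
  exact le_mul_of_one_le_right (by positivity) h2

/-- The bound just proved, weakened to the constant that yields `c_d^*`: it uses `e ≤ 3 ≤ d + 1`,
`2^(d/2) ≤ 2^d` and `Γ(3/2) < 1`. -/
lemma gaussian_mean_le (hd : 2 ≤ d) (e : Sph d) {s : ℝ} (hs : 2 ≤ s) :
    ∫ y : Sph d, Real.exp (-s * ‖(e : Euc d) - y‖ ^ 2) ∂(sigma d) ≤
      gaussConst d * s ^ (-(d : ℝ) / 2) := by
  have hd' : (2 : ℝ) ≤ d := by exact_mod_cast hd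
  have h := gaussian_mean_le_of_one_le e (s := s / 2) (by linarith)
  rw [mul_div_cancel₀ s two_ne_zero] at h
  refine h.trans ?_
  rw [Real.div_rpow (by linarith) two_pos.le, mul_div_assoc', div_eq_mul_inv, neg_div,
    Real.rpow_neg two_pos.le, inv_inv, mul_right_comm]
  refine mul_le_mul_of_nonneg_right ?_ (Real.rpow_nonneg (by linarith) _)
  have hG : Real.Gamma (((d : ℝ) + 3) / 2) =
      ((d : ℝ) + 1) / 2 * Real.Gamma (((d : ℝ) + 1) / 2) := by
    rw [← Real.Gamma_add_one (by positivity)]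
    congr 1
    ring
  have hG0 : 0 < Real.Gamma (((d : ℝ) + 1) / 2) := Real.Gamma_pos_of_pos (by positivity)
  have h2 : (2 : ℝ) ^ ((d : ℝ) / 2) ≤ 2 ^ d := by
    rw [← Real.rpow_natCast]
    exact Real.rpow_le_rpow_of_exponent_le one_le_two (by linarith)
  have he : Real.exp 1 ≤ 3 := by linarith [Real.exp_one_lt_d9]
  rw [gaussConst, hG]
  have h3 : Real.exp 1 / 2 * Real.Gamma (((d : ℝ) + 1) / 2) ≤
      ((d : ℝ) + 1) / 2 * Real.Gamma (((d : ℝ) + 1) / 2) / Real.Gamma (3 / 2) := by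
    refine le_trans ?_ (le_div_self (by positivity) Gamma_three_halves_pos
      Gamma_three_halves_lt_one.le)
    gcongr
    linarith
  rw [mul_comm (2 ^ d)]
  exact mul_le_mul h3 h2 (by positivity)
    (div_nonneg (by positivity) Gamma_three_halves_pos.le)

end GaussianMean

/-! ### The distance as a superposition of Gaussians. -/

section Subordination

/-- The integrand in the subordination formula for the distance. -/
noncomputable def subord (u s : ℝ) : ℝ := (1 - Real.exp (-s * u ^ 2)) * s ^ (-(3 / 2) : ℝ)

lemma subord_nonneg (u : ℝ) {s : ℝ} (hs : 0 < s) : 0 ≤ subord u s := by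
  refine mul_nonneg (sub_nonneg.2 (Real.exp_le_one_iff.2 ?_)) (by positivity)
  have := mul_nonneg hs.le (sq_nonneg u)
  linarith

lemma subord_mono {u v s : ℝ} (hs : 0 < s) (hu : 0 ≤ u) (huv : u ≤ v) :
    subord u s ≤ subord v s := by
  unfold subord
  have : -s * v ^ 2 ≤ -s * u ^ 2 := by
    have : s * u ^ 2 ≤ s * v ^ 2 := by gcongr
    linarith
  gcongr

lemma subord_le_left (u : ℝ) {s : ℝ} (hs : 0 < s) : subord u s ≤ u ^ 2 * s ^ (-(1 / 2) : ℝ) := by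
  have h1 : s ^ (-(1 / 2) : ℝ) = s * s ^ (-(3 / 2) : ℝ) := by
    rw [← Real.rpow_one_add' hs.le (by norm_num)]
    norm_num
  have h2 := Real.add_one_le_exp (-s * u ^ 2)
  rw [h1, subord, ← mul_assoc]
  gcongr
  linarith

lemma subord_le_right (u : ℝ) {s : ℝ} (hs : 0 < s) : subord u s ≤ s ^ (-(3 / 2) : ℝ) := by
  have h2 := Real.exp_pos (-s * u ^ 2)
  exact mul_le_of_le_one_left (by positivity) (by linarith)

lemma measurable_subord : Measurable fun q : ℝ × ℝ => subord q.1 q.2 := by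
  unfold subord
  fun_prop

lemma integrableOn_subord (u : ℝ) : IntegrableOn (subord u) (Set.Ioi 0) := by
  have hm : Measurable (subord u) := measurable_subord.comp (measurable_const.prodMk measurable_id)
  rw [← Set.Ioc_union_Ioi_eq_Ioi zero_le_one, integrableOn_union]
  constructor
  · have h : IntegrableOn (fun s : ℝ => u ^ 2 * s ^ (-(1 / 2) : ℝ)) (Set.Ioc 0 1) := by
      have := (intervalIntegral.intervalIntegrable_rpow' (a := 0) (b := 1)
        (r := -(1 / 2)) (by norm_num)).const_mul (u ^ 2)
      rwa [intervalIntegrable_iff_integrableOn_Ioc_of_le zero_le_one] at this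
    refine Integrable.mono' h hm.aestronglyMeasurable
      ((ae_restrict_mem measurableSet_Ioc).mono fun s hs => ?_)
    rw [Real.norm_of_nonneg (subord_nonneg u hs.1)]
    exact subord_le_left u hs.1
  · refine Integrable.mono' (integrableOn_Ioi_rpow_of_lt (a := -(3 / 2)) (by norm_num) one_pos)
      hm.aestronglyMeasurable ((ae_restrict_mem measurableSet_Ioi).mono fun s hs => ?_)
    have hs0 : 0 < s := one_pos.trans hs
    rw [Real.norm_of_nonneg (subord_nonneg u hs0)]
    exact subord_le_right u hs0

lemma integrableOn_rpow_mul_exp_neg {b : ℝ} (hb : 0 < b) :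
    IntegrableOn (fun s : ℝ => s ^ (-(1 / 2) : ℝ) * Real.exp (-s * b)) (Set.Ioi 0) := by
  have h := integrableOn_rpow_mul_exp_neg_mul_rpow (s := -(1 / 2)) (p := 1) (b := b)
    (by norm_num) one_pos hb
  refine h.congr_fun (fun s _ => ?_) measurableSet_Ioi
  simp only [Real.rpow_one]
  ring_nf

/-- Integration by parts against the antiderivative `-2 s^(-1/2)` of `s^(-3/2)`: both boundary terms
vanish, and the remaining integral is a `Γ(1/2)` integral. -/
theorem integral_subord {u : ℝ} (hu : 0 ≤ u) :
    ∫ s in Set.Ioi (0 : ℝ), subord u s = 2 * √Real.pi * u := by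
  rcases hu.eq_or_lt with rfl | hu0
  · simp [subord]
  have hu2 : 0 < u ^ 2 := by positivity
  have hg : ∫ s in Set.Ioi (0 : ℝ), s ^ (-(1 / 2) : ℝ) * Real.exp (-s * u ^ 2) = √Real.pi / u := by
    have h := Real.integral_rpow_mul_exp_neg_mul_Ioi (a := 1 / 2) (r := u ^ 2) (by norm_num) hu2
    rw [Real.Gamma_one_half_eq, ← Real.sqrt_eq_rpow, Real.sqrt_div zero_le_one, Real.sqrt_one,
      Real.sqrt_sq hu] at h
    rw [show √Real.pi / u = 1 / u * √Real.pi by ring, ← h]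
    refine setIntegral_congr_fun measurableSet_Ioi fun s _ => ?_
    norm_num
    left
    ring
  have h1 (s : ℝ) (hs : s ∈ Set.Ioi (0 : ℝ)) :
      HasDerivAt (fun s : ℝ => -2 * s ^ (-(1 / 2) : ℝ)) (s ^ (-(3 / 2) : ℝ)) s := by
    have h1 := (Real.hasDerivAt_rpow_const (p := -(1 / 2)) (Or.inl hs.out.ne')).const_mul (-2 : ℝ)
    convert! h1 using 1
    rw [show (-(1 / 2) - 1 : ℝ) = -(3 / 2) by norm_num]
    ring
  have h2 (s : ℝ) (_ : s ∈ Set.Ioi (0 : ℝ)) :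
      HasDerivAt (fun s : ℝ => 1 - Real.exp (-s * u ^ 2)) (Real.exp (-s * u ^ 2) * u ^ 2) s := by
    have h2 := ((hasDerivAt_neg s).mul_const (u ^ 2)).exp.const_sub 1
    convert! h2 using 1
    ring
  have t0 : Tendsto (fun s => -2 * s ^ (-(1 / 2) : ℝ) * (1 - Real.exp (-s * u ^ 2)))
      (𝓝[>] 0) (𝓝 0) := by
    have hb : Tendsto (fun s : ℝ => 2 * u ^ 2 * √s) (𝓝[>] 0) (𝓝 0) := by
      have : Continuous fun s : ℝ => 2 * u ^ 2 * √s := by fun_prop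
      have h := this.tendsto 0
      simp only [Real.sqrt_zero, mul_zero] at h
      exact h.mono_left nhdsWithin_le_nhds
    refine squeeze_zero_norm' ?_ hb
    filter_upwards [self_mem_nhdsWithin] with s hs
    have hs0 : 0 < s := hs
    have e : -2 * s ^ (-(1 / 2) : ℝ) * (1 - Real.exp (-s * u ^ 2)) = -(2 * s * subord u s) := by
      have h1 : s ^ (-(1 / 2) : ℝ) = s * s ^ (-(3 / 2) : ℝ) := by
        rw [← Real.rpow_one_add' hs0.le (by norm_num)]
        norm_num
      rw [h1, subord]
      ring
    have h2 := subord_nonneg u hs0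
    rw [e, norm_neg, Real.norm_of_nonneg (by positivity)]
    calc 2 * s * subord u s ≤ 2 * s * (u ^ 2 * s ^ (-(1 / 2) : ℝ)) := by
          gcongr
          exact subord_le_left u hs0
      _ = 2 * u ^ 2 * (s * s ^ (-(1 / 2) : ℝ)) := by ring
      _ = 2 * u ^ 2 * √s := by
          rw [← Real.rpow_one_add' hs0.le (by norm_num), Real.sqrt_eq_rpow]
          norm_num
  have t1 : Tendsto (fun s => -2 * s ^ (-(1 / 2) : ℝ) * (1 - Real.exp (-s * u ^ 2)))
      atTop (𝓝 0) := by
    have h1 := tendsto_rpow_neg_atTop (y := 1 / 2) (by norm_num)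
    have h2 : Tendsto (fun s : ℝ => Real.exp (-s * u ^ 2)) atTop (𝓝 0) :=
      Real.tendsto_exp_atBot.comp (tendsto_neg_atTop_atBot.atBot_mul_const hu2)
    simpa using (h1.const_mul (-2)).mul (h2.const_sub 1)
  have hi := (integrableOn_rpow_mul_exp_neg hu2).const_mul (2 * u ^ 2)
  have e (s : ℝ) : s ^ (-(3 / 2) : ℝ) * (1 - Real.exp (-s * u ^ 2)) +
      -2 * s ^ (-(1 / 2) : ℝ) * (Real.exp (-s * u ^ 2) * u ^ 2) =
      subord u s - 2 * u ^ 2 * (s ^ (-(1 / 2) : ℝ) * Real.exp (-s * u ^ 2)) := by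
    rw [subord]
    ring
  have hmain := integral_Ioi_deriv_mul_eq_sub h1 h2
    (((integrableOn_subord u).sub hi).congr (Eventually.of_forall fun s => (e s).symm)) t0 t1
  simp only [e] at hmain
  rw [integral_sub (integrableOn_subord u) hi, integral_const_mul, hg] at hmain
  field_simp at hmain
  linarith

end Subordination

/-! ### The lower bound and the constant for `d = 2`. -/

section LowerBound

variable {d : ℕ}

/-- The Gaussian energy of a finite set of points minus that of the uniform measure. -/
noncomputable def gaussGap {N : ℕ} (p : Fin N → Sph d) (e : Sph d) (s : ℝ) : ℝ :=
  (∑ j, ∑ k, Real.exp (-s * ‖(p j : Euc d) - p k‖ ^ 2)) / (N : ℝ) ^ 2 -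
    ∫ y : Sph d, Real.exp (-s * ‖(e : Euc d) - y‖ ^ 2) ∂(sigma d)

lemma integrable_subord_norm_sub (e : Sph d) :
    Integrable (Function.uncurry fun (y : Sph d) (s : ℝ) => subord ‖(e : Euc d) - y‖ s)
      ((sigma d).prod (volume.restrict (Set.Ioi 0))) := by
  -- `2` is the diameter of the sphere and `subord` increases with the distance, so `subord 2`
  -- dominates.
  have h := (integrableOn_subord 2).comp_snd (sigma d)
  have hm : Measurable (Function.uncurry fun (y : Sph d) (s : ℝ) => subord ‖(e : Euc d) - y‖ s) :=
    measurable_subord.comp (f := fun q : Sph d × ℝ => (‖(e : Euc d) - q.1‖, q.2)) (by fun_prop)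
  refine h.mono' hm.aestronglyMeasurable ?_
  have hs : ∀ᵐ q ∂((sigma d).prod (volume.restrict (Set.Ioi (0 : ℝ)))), q.2 ∈ Set.Ioi (0 : ℝ) :=
    Measure.quasiMeasurePreserving_snd.ae (ae_restrict_mem measurableSet_Ioi)
  filter_upwards [hs] with q hq
  rw [Function.uncurry, Real.norm_of_nonneg (subord_nonneg _ hq)]
  refine subord_mono hq (norm_nonneg _) ((norm_sub_le _ _).trans ?_)
  rw [norm_sph, norm_sph]
  norm_num

/-- The constant `1` in `subord` has the same average under both measures and cancels; the minus
sign before the exponential swaps the two terms. -/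
lemma gaussGap_mul_eq {N : ℕ} (hN : N ≠ 0) (p : Fin N → Sph d) (e : Sph d) (s : ℝ) :
    gaussGap p e s * s ^ (-(3 / 2) : ℝ) = ∫ y : Sph d, subord ‖(e : Euc d) - y‖ s ∂(sigma d) -
      (∑ j, ∑ k, subord ‖(p j : Euc d) - p k‖ s) / (N : ℝ) ^ 2 := by
  have hN' : (N : ℝ) ≠ 0 := by exact_mod_cast hN
  simp only [subord, gaussGap, ← Finset.sum_mul, Finset.sum_sub_distrib, Finset.sum_const,
    Finset.card_univ, Fintype.card_fin, nsmul_eq_mul, mul_one]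
  rw [integral_mul_const, integral_sub (integrable_const _)
    (Continuous.integrable_of_hasCompactSupport (by fun_prop)
      (HasCompactSupport.of_compactSpace _))]
  simp only [integral_const, probReal_univ, smul_eq_mul, mul_one]
  field_simp
  ring

lemma integrableOn_gaussGap_mul {N : ℕ} (hN : N ≠ 0) (p : Fin N → Sph d) (e : Sph d) :
    IntegrableOn (fun s => gaussGap p e s * s ^ (-(3 / 2) : ℝ)) (Set.Ioi 0) := by
  simp only [gaussGap_mul_eq hN]
  exact (integrable_subord_norm_sub e).integral_prod_right.sub
    ((integrable_finsetSum _ fun j _ => integrable_finsetSum _ fun k _ =>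
      integrableOn_subord _).div_const _)

lemma distance_gap_eq {N : ℕ} (hN : N ≠ 0) (p : Fin N → Sph d) (e : Sph d) :
    2 * √Real.pi * (∫ y : Sph d, ‖(e : Euc d) - y‖ ∂(sigma d) -
      (∑ j, ∑ k, ‖(p j : Euc d) - p k‖) / (N : ℝ) ^ 2) =
    ∫ s in Set.Ioi (0 : ℝ), gaussGap p e s * s ^ (-(3 / 2) : ℝ) := by
  have hsum : IntegrableOn (fun s => ∑ j, ∑ k, subord ‖(p j : Euc d) - p k‖ s) (Set.Ioi 0) :=
    integrable_finsetSum _ fun j _ => integrable_finsetSum _ fun k _ => integrableOn_subord _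
  have hsub : IntegrableOn (fun s => ∫ y : Sph d, subord ‖(e : Euc d) - y‖ s ∂(sigma d))
    (Set.Ioi 0) := (integrable_subord_norm_sub e).integral_prod_right
  simp only [gaussGap_mul_eq hN]
  rw [integral_sub hsub (hsum.div_const _),
    ← integral_integral_swap (integrable_subord_norm_sub e), integral_div,
    integral_finsetSum _ fun j _ => integrable_finsetSum _ fun k _ => integrableOn_subord _]
  rw [Finset.sum_congr rfl fun j _ => integral_finsetSum _ fun k _ => integrableOn_subord _]
  simp only [integral_subord (norm_nonneg _), integral_const_mul, ← Finset.mul_sum]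
  ring

/-- Only the `N` diagonal terms, each equal to `1`, are kept from the double sum. -/
lemma one_div_sub_le_gaussGap (hd : 2 ≤ d) {N : ℕ} (hN : N ≠ 0) (p : Fin N → Sph d) (e : Sph d)
    {s : ℝ} (hs : 2 ≤ s) : 1 / (N : ℝ) - gaussConst d * s ^ (-(d : ℝ) / 2) ≤ gaussGap p e s := by
  have hN' : (N : ℝ) ≠ 0 := by exact_mod_cast hN
  refine sub_le_sub ?_ (gaussian_mean_le hd e hs)
  have h : (N : ℝ) ≤ ∑ j, ∑ k, Real.exp (-s * ‖(p j : Euc d) - p k‖ ^ 2) := by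
    calc (N : ℝ) = ∑ _j : Fin N, (1 : ℝ) := by simp
      _ ≤ _ := Finset.sum_le_sum fun j _ => by
        have := Finset.single_le_sum (f := fun k => Real.exp (-s * ‖(p j : Euc d) - p k‖ ^ 2))
          (fun k _ => (Real.exp_pos _).le) (Finset.mem_univ j)
        simpa using this
  calc 1 / (N : ℝ) = N / (N : ℝ) ^ 2 := by field_simp
    _ ≤ _ := by gcongr

/-- `S` is the zero of `1/M - A s^(-d/2)`, hence the cut-off that maximizes the integral. -/
lemma integral_threshold {A M S : ℝ} (hA : 0 < A) (hM : 0 < M) (hd : d ≠ 0)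
    (hS : S = (A * M) ^ (2 / (d : ℝ))) :
    IntegrableOn (fun s : ℝ => (1 / M - A * s ^ (-(d : ℝ) / 2)) * s ^ (-(3 / 2) : ℝ)) (Set.Ioi S) ∧
    ∫ s in Set.Ioi S, (1 / M - A * s ^ (-(d : ℝ) / 2)) * s ^ (-(3 / 2) : ℝ) =
      2 / (1 + 1 / (d : ℝ)) * (A * M) ^ (-(1 / (d : ℝ))) / M := by
  have hd0 : (0 : ℝ) < d := by positivity
  have hAM : 0 < A * M := by positivity
  have hS0 : 0 < S := by rw [hS]; positivity
  have e : ∀ s ∈ Set.Ioi S, (1 / M - A * s ^ (-(d : ℝ) / 2)) * s ^ (-(3 / 2) : ℝ) =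
      1 / M * s ^ (-(3 / 2) : ℝ) - A * s ^ (-(d : ℝ) / 2 - 3 / 2) := by
    intro s hs
    rw [sub_mul, mul_assoc A, ← Real.rpow_add (hS0.trans hs), ← sub_eq_add_neg]
  have i1 : IntegrableOn (fun s : ℝ => 1 / M * s ^ (-(3 / 2) : ℝ)) (Set.Ioi S) :=
    (integrableOn_Ioi_rpow_of_lt (by norm_num) hS0).const_mul _
  have i2 : IntegrableOn (fun s : ℝ => A * s ^ (-(d : ℝ) / 2 - 3 / 2)) (Set.Ioi S) :=
    (integrableOn_Ioi_rpow_of_lt (by linarith) hS0).const_mul _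
  refine ⟨(i1.sub i2).congr_fun (fun s hs => (e s hs).symm) measurableSet_Ioi, ?_⟩
  rw [setIntegral_congr_fun measurableSet_Ioi e, integral_sub i1 i2, integral_const_mul,
    integral_const_mul, integral_Ioi_rpow_of_lt (by norm_num) hS0,
    integral_Ioi_rpow_of_lt (by linarith) hS0]
  have h1 : S ^ (-(3 / 2) + 1 : ℝ) = (A * M) ^ (-(1 / (d : ℝ))) := by
    rw [hS, ← Real.rpow_mul hAM.le]
    congr 1
    field_simp
    norm_num
  have h2 : S ^ (-(d : ℝ) / 2 - 3 / 2 + 1) = (A * M) ^ (-(1 / (d : ℝ))) / (A * M) := by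
    rw [hS, ← Real.rpow_mul hAM.le, ← Real.rpow_sub_one hAM.ne']
    congr 1
    field_simp
    ring
  rw [h1, h2]
  have h3 : -(d : ℝ) / 2 - 3 / 2 + 1 ≠ 0 := by linarith
  have h4 : -(d : ℝ) - 3 + 2 ≠ 0 := by linarith
  have h5 : (d : ℝ) + 1 ≠ 0 := by linarith
  have h6 : -(d : ℝ) / 2 - 3 / 2 + 1 = -((d : ℝ) + 1) / 2 := by ring
  rw [h6]
  field_simp
  ring

/-- The factor `2^d` in `gaussConst` becomes `1/2` and absorbs the leading `2`, leaving the Gamma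
quotient of `c_d^*`. -/
lemma gaussConst_mul_rpow (d : ℕ) (hd : d ≠ 0) {M : ℝ} (hM : 0 < M) :
    2 * (gaussConst d * M) ^ (-(1 / (d : ℝ))) =
      (Real.Gamma (3 / 2) / Real.Gamma (((d : ℝ) + 3) / 2)) ^ (1 / (d : ℝ)) *
        M ^ (-(1 / (d : ℝ))) := by
  have hd0 : (d : ℝ) ≠ 0 := by exact_mod_cast hd
  have hg1 := Gamma_three_halves_pos
  have hg2 : 0 < Real.Gamma (((d : ℝ) + 3) / 2) := Real.Gamma_pos_of_pos (by positivity)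
  have h2 : ((2 : ℝ) ^ d) ^ (-(1 / (d : ℝ))) = 2⁻¹ := by
    rw [← Real.rpow_natCast, ← Real.rpow_mul two_pos.le, ← Real.rpow_neg_one]
    congr 1
    field_simp
  rw [gaussConst, Real.mul_rpow (by positivity) hM.le, Real.mul_rpow (by positivity) (by positivity),
    h2, Real.rpow_neg (div_nonneg hg2.le hg1.le), ← Real.inv_rpow (div_nonneg hg2.le hg1.le),
    inv_div]
  ring

lemma distance_gap_lower_bound (hd : 2 ≤ d) {N : ℕ} (hN : N ≠ 0) (p : Fin N → Sph d) (e : Sph d) :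
    1 / (1 + 1 / (d : ℝ)) *
      (Real.Gamma (3 / 2) / Real.Gamma (((d : ℝ) + 3) / 2)) ^ (1 / (d : ℝ)) *
      (N : ℝ) ^ (-1 - 1 / (d : ℝ)) ≤
    2 * √Real.pi * (∫ y : Sph d, ‖(e : Euc d) - y‖ ∂(sigma d) -
      (∑ j, ∑ k, ‖(p j : Euc d) - p k‖) / (N : ℝ) ^ 2) := by
  have hd0 : d ≠ 0 := by omega
  have hN1 : (1 : ℝ) ≤ N := by exact_mod_cast Nat.one_le_iff_ne_zero.2 hN
  have hN0 : (0 : ℝ) < N := by linarith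
  have hA := two_pow_le_gaussConst hd
  have hA0 : 0 < gaussConst d := lt_of_lt_of_le (by positivity) hA
  set S := (gaussConst d * N) ^ (2 / (d : ℝ)) with hS
  have hS2 : 2 ≤ S := by
    have h1 : (2 : ℝ) ^ d ≤ gaussConst d * N := hA.trans (le_mul_of_one_le_right hA0.le hN1)
    calc (2 : ℝ) ≤ (2 : ℝ) ^ (2 : ℝ) := by norm_num
      _ = ((2 : ℝ) ^ d) ^ (2 / (d : ℝ)) := by
        rw [← Real.rpow_natCast, ← Real.rpow_mul two_pos.le]
        congr 1
        field_simp
      _ ≤ S := Real.rpow_le_rpow (by positivity) h1 (by positivity)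
  obtain ⟨hi, hv⟩ := integral_threshold (d := d) hA0 hN0 hd0 hS
  have hgap := integrableOn_gaussGap_mul hN p e
  rw [distance_gap_eq hN]
  calc _ = 2 / (1 + 1 / (d : ℝ)) * (gaussConst d * N) ^ (-(1 / (d : ℝ))) / N := by
        have h := gaussConst_mul_rpow d hd0 hN0
        have h' : (N : ℝ) ^ (-1 - 1 / (d : ℝ)) = (N : ℝ) ^ (-(1 / (d : ℝ))) / N := by
          rw [← Real.rpow_sub_one hN0.ne']
          congr 1
          ring
        rw [h', mul_assoc, mul_div_assoc', ← h]
        ring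
    _ = ∫ s in Set.Ioi S, (1 / (N : ℝ) - gaussConst d * s ^ (-(d : ℝ) / 2)) *
        s ^ (-(3 / 2) : ℝ) := hv.symm
    _ ≤ ∫ s in Set.Ioi S, gaussGap p e s * s ^ (-(3 / 2) : ℝ) := by
        refine setIntegral_mono_on hi (hgap.mono_set (Set.Ioi_subset_Ioi (by linarith)))
          measurableSet_Ioi fun s hs => ?_
        have hs2 : 2 ≤ s := hS2.trans hs.out.le
        exact mul_le_mul_of_nonneg_right (one_div_sub_le_gaussGap hd hN p e hs2)
          (Real.rpow_nonneg (by linarith) _)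
    -- The range `(0, S]` is dropped because the gap is nonnegative there.
    _ ≤ _ := by
        refine setIntegral_mono_set hgap ?_ (Set.Ioi_subset_Ioi (by linarith)).eventuallyLE
        filter_upwards [ae_restrict_mem measurableSet_Ioi] with s hs
        exact mul_nonneg (gaussian_energy_nonneg hN p e hs.out.le)
          (Real.rpow_nonneg hs.out.le _)

lemma Cconst_pos (hd : d ≠ 0) : 0 < Cconst d := by
  have hd0 : (0 : ℝ) < d := by positivity
  have h1 : 0 < Real.Gamma (((d : ℝ) + 1) / 2) := Real.Gamma_pos_of_pos (by positivity)
  have h2 : 0 < Real.Gamma ((d : ℝ) / 2) := Real.Gamma_pos_of_pos (by positivity)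
  have h3 := Real.pi_pos
  unfold Cconst
  positivity

theorem cStar_mul_le_discrepancy (hd : 2 ≤ d) {N : ℕ} (hN : N ≠ 0) (p : Fin N → Sph d) :
    cStar d * (N : ℝ) ^ (-(1 / 2 : ℝ) - 1 / (2 * (d : ℝ))) ≤ discrepancy p := by
  have hd0 : d ≠ 0 := by omega
  have hN0 : (0 : ℝ) < N := by positivity
  -- Any base point serves, since spherical means of functions of the distance do not depend on it.
  have e : Sph d := p ⟨0, Nat.pos_of_ne_zero hN⟩
  have hC := Cconst_pos hd0
  have hpow : (N : ℝ) ^ (-(1 / 2 : ℝ) - 1 / (2 * (d : ℝ))) = √((N : ℝ) ^ (-1 - 1 / (d : ℝ))) := by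
    rw [Real.sqrt_eq_rpow, ← Real.rpow_mul hN0.le]
    congr 1
    field_simp
  have hpi : 0 < √Real.pi := Real.sqrt_pos.2 Real.pi_pos
  rw [discrepancy_eq hd0 hN p e, cStar, hpow, ← Real.sqrt_mul' _ (Real.rpow_nonneg hN0.le _)]
  refine Real.sqrt_le_sqrt ?_
  have h := mul_le_mul_of_nonneg_left (distance_gap_lower_bound hd hN p e)
    (show 0 ≤ Cconst d / (2 * √Real.pi) by positivity)
  refine le_trans (le_of_eq ?_) (h.trans (le_of_eq ?_))
  · ring
  · field_simp

theorem cStar_two : cStar 2 = √(1 / (6 * √(6 * Real.pi))) := by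
  have hpi := Real.pi_pos
  have hsp : 0 < √Real.pi := Real.sqrt_pos.2 hpi
  have hC : Cconst 2 = 1 / 4 := by
    rw [Cconst]
    norm_num [Gamma_three_halves]
    field_simp
    norm_num
  have hG : Real.Gamma (((2 : ℕ) + 3) / 2) = 3 / 2 * Real.Gamma (3 / 2) := by
    rw [← Real.Gamma_add_one (by norm_num)]
    norm_num
  -- `2/3` is written as `6/3²` so that its square root becomes `√6/3`.
  have hq : Real.Gamma (3 / 2) / (3 / 2 * Real.Gamma (3 / 2)) = 6 / 3 ^ 2 := by
    have := Gamma_three_halves_pos.ne'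
    field_simp
    norm_num
  rw [cStar, hC, hG, hq]
  push_cast
  rw [← Real.sqrt_eq_rpow, Real.sqrt_div (by norm_num), Real.sqrt_sq (by norm_num),
    Real.sqrt_mul (show (0 : ℝ) ≤ 6 by norm_num) Real.pi]
  congr 1
  have h6 : √6 * √6 = (6 : ℝ) := Real.mul_self_sqrt (by norm_num)
  have h60 : (0 : ℝ) < √6 := by positivity
  field_simp
  nlinarith

end LowerBound

end CapDiscrepancy

theorem mainTheorem5 :
    (∀ d : ℕ, 2 ≤ d → ∀ N : ℕ, 2 ≤ N → ∀ p : Fin N → CapDiscrepancy.Sph d,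
      CapDiscrepancy.cStar d * (N : ℝ) ^ (-(1 / 2 : ℝ) - 1 / (2 * (d : ℝ))) ≤
        CapDiscrepancy.discrepancy p) ∧
    CapDiscrepancy.cStar 2 = √(1 / (6 * √(6 * Real.pi))) :=
  ⟨fun _ hd _ hN p => CapDiscrepancy.cStar_mul_le_discrepancy hd (by omega) p,
    CapDiscrepancy.cStar_two⟩
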